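/- A Köthe matrix is a matrix $A=(a_{j,q})_{j\in\mathbb N,q\in\mathbb N_0}$ of non-negative numbers such that $a_{j,q}\le a_{j,q+1}$ for all $j,q$ and for each $j$ there is $q$ with $a_{j,q}>0$. The Köthe space $\lambda^\infty(A)$ consists of all $\xi\in\mathbb C^{\mathbb N}$ with $|\xi|_{\infty,q}:=\sup_{j}|\xi_j|a_{j,q}<\infty$ for all $q\in\mathbb N_0$, with the locally convex topology given by the seminorms $|\cdot|_{\infty,q}$; if $\lambda^\infty(A)\subset c_0$, it is a Fréchet ${}^*$-algebra with pointwise multiplication and conjugation. For $\mathcal N\subset\mathbb N$ let $e_{\mathcal N}$ be the sequence which is $1$ on $\mathcal N$ and $0$ otherwise, and let $e_k:=e_{\{k\}}$. Let $A=(a_{j,q})$ be a Köthe matrix such that $\lambda^\infty(A)$ is nuclear and $\lambda^\infty(A)\subset c_0$. Let $E$ be an infinite-dimensional closed ${}^*$-subalgebra of $\lambda^\infty(A)$. Then there is a family $\{\mathcal N_k\}_{k\in\mathbb N}$ of finite nonempty pairwise disjoint subsets of $\mathbb N$ such that (i) $(e_{\mathcal N_k})_{k\in\mathbb N}$ is a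 Schauder basis of $E$; (ii) $E\cong\lambda^\infty\left(\max_{j\in\mathcal N_k}a_{j,q}\right)$ as Fréchet ${}^*$-algebras, where the matrix on the right has rows indexed by $k\in\mathbb N$ and columns indexed by $q\in\mathbb N_0$, by an isomorphism with $e_{\mathcal N_k}\mapsto e_k$ for all $k\in\mathbb N$. Conversely, if $\{\mathcal N_k\}_{k\in\mathbb N}$ is a family of finite nonempty pairwise disjoint subsets of $\mathbb N$ and $F$ is the closed ${}^*$-subalgebra of $\lambda^\infty(A)$ generated by $\{e_{\mathcal N_k}:k\in\mathbb N\}$, then (iii) $(e_{\mathcal N_k})_{k\in\mathbb N}$ is a Schauder basis of $F$; (iv) $F\cong\lambda^\infty\left(\max_{j\in\mathcal N_k}a_{j,q}\right)$ as Fréchet ${}^*$-algebras, by an isomorphism with $e_{\mathcal N_k}\mapsto e_k$ for all $k\in\mathbb N$. -/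

import Mathlib

open Filter Topology

noncomputable section

/-! ### Nuclear locally convex spaces -/

/-- The space `E` seminormed by the single seminorm `p`. Its completion (which is Hausdorff, so
that the kernel of `p` is divided out) is the local Banach space of `E` at `p`. -/
def Seminorm.LocalSpace {E : Type*} [AddCommGroup E] [Module ℂ E] (_p : Seminorm ℂ E) : Type _ := E

namespace Seminorm.LocalSpace

variable {E : Type*} [AddCommGroup E] [Module ℂ E] (p : Seminorm ℂ E)

instance : SeminormedAddCommGroup p.LocalSpace :=
  p.toAddGroupSeminorm.toSeminormedAddCommGroup

instance : NormedSpace ℂ p.LocalSpace :=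
  { (inferInstance : Module ℂ E) with
    norm_smul_le := fun c x => (map_smul_eq_mul p c x).le }

/-- The canonical map of `E` into its local Banach space at `p`. -/
def toBanach (x : E) : UniformSpace.Completion p.LocalSpace :=
  ((show p.LocalSpace from x : p.LocalSpace) : UniformSpace.Completion p.LocalSpace)

end Seminorm.LocalSpace

/-- A locally convex space `E` is nuclear if for every continuous seminorm `p` there is a
continuous seminorm `q ≥ p` such that the canonical map from the local Banach space at `q` to the
local Banach space at `p` is nuclear, i.e. of the form `x ↦ ∑ f n x • y n` with functionals `f n`
of `q`-norm at most `c n` and `∑ c n * ‖y n‖ < ∞`. -/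
def IsNuclearSpace (E : Type*) [AddCommGroup E] [Module ℂ E] [TopologicalSpace E] : Prop :=
  ∀ p : Seminorm ℂ E, Continuous p →
    ∃ q : Seminorm ℂ E, Continuous q ∧ p ≤ q ∧
      ∃ (f : ℕ → E →ₗ[ℂ] ℂ) (c : ℕ → NNReal) (y : ℕ → UniformSpace.Completion p.LocalSpace),
        (∀ n x, ‖f n x‖ ≤ c n * q x) ∧
        Summable (fun n => (c n : ℝ) * ‖y n‖) ∧
        ∀ x : E, HasSum (fun n => f n x • y n) (Seminorm.LocalSpace.toBanach p x)

/-! ### Schauder bases of topological vector spaces -/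

/-- `e` is a Schauder basis of `X`: every vector has a unique expansion as a convergent series
`∑ c k • e k`, and the coefficients depend continuously on the vector. -/
def IsSchauderBasis {X : Type*} [AddCommGroup X] [Module ℂ X] [TopologicalSpace X]
    (e : ℕ → X) : Prop :=
  (∀ x : X, ∃! c : ℕ → ℂ,
    Tendsto (fun n => ∑ k ∈ Finset.range n, c k • e k) atTop (𝓝 x)) ∧
  ∃ f : ℕ → X →L[ℂ] ℂ, ∀ x : X,
    Tendsto (fun n => ∑ k ∈ Finset.range n, f k x • e k) atTop (𝓝 x)

/-! ### Köthe matrices and Köthe spaces -/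

/-- A Köthe matrix `(a j q)`. -/
structure KoetheMatrix where
  a : ℕ → ℕ → ℝ
  nonneg : ∀ j q, 0 ≤ a j q
  exists_pos : ∀ j, ∃ q, 0 < a j q
  mono : ∀ j q, a j q ≤ a j (q + 1)

namespace KoetheMatrix

/-- The sequences `ξ` with `sup_j |ξ j| * a j q < ∞` for all `q`, as a set of sequences. -/
def submodule (A : KoetheMatrix) : Submodule ℂ (ℕ → ℂ) where
  carrier := {ξ | ∀ q, BddAbove (Set.range fun j => ‖ξ j‖ * A.a j q)}
  zero_mem' := fun q => ⟨0, by rintro _ ⟨j, rfl⟩; simp⟩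
  add_mem' := by
    intro ξ η hξ hη q
    obtain ⟨C, hC⟩ := hξ q
    obtain ⟨D, hD⟩ := hη q
    refine ⟨C + D, ?_⟩
    rintro _ ⟨j, rfl⟩
    have h1 : ‖ξ j‖ * A.a j q ≤ C := hC ⟨j, rfl⟩
    have h2 : ‖η j‖ * A.a j q ≤ D := hD ⟨j, rfl⟩
    have h3 := mul_le_mul_of_nonneg_right (norm_add_le (ξ j) (η j)) (A.nonneg j q)
    simp only [Pi.add_apply]
    linarith
  smul_mem' := by
    intro c ξ hξ q
    obtain ⟨C, hC⟩ := hξ q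
    refine ⟨‖c‖ * C, ?_⟩
    rintro _ ⟨j, rfl⟩
    have h1 : ‖ξ j‖ * A.a j q ≤ C := hC ⟨j, rfl⟩
    simp only [Pi.smul_apply, smul_eq_mul, norm_mul, mul_assoc]
    exact mul_le_mul_of_nonneg_left h1 (norm_nonneg c)

end KoetheMatrix

/-- The Köthe space `λ^∞(A)`. It is a type of its own, so that it does not inherit the topology of
pointwise convergence. -/
def KoetheSpace (A : KoetheMatrix) : Type := A.submodule

namespace KoetheSpace

variable {A : KoetheMatrix}

instance : AddCommGroup (KoetheSpace A) := inferInstanceAs (AddCommGroup A.submodule)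
instance : Module ℂ (KoetheSpace A) := inferInstanceAs (Module ℂ A.submodule)

instance : CoeFun (KoetheSpace A) (fun _ => ℕ → ℂ) := ⟨fun ξ => ξ.1⟩

/-- The seminorm `|ξ|_{∞,q} = sup_j |ξ j| * a j q`. -/
def seminorm (A : KoetheMatrix) (q : ℕ) : Seminorm ℂ (KoetheSpace A) :=
  Seminorm.of (fun ξ => ⨆ j, ‖ξ j‖ * A.a j q)
    (by
      intro ξ η
      refine ciSup_le fun j => ?_
      have h1 := le_ciSup (ξ.2 q) j
      have h2 := le_ciSup (η.2 q) j
      have h3 := mul_le_mul_of_nonneg_right (norm_add_le (ξ j) (η j)) (A.nonneg j q)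
      have h4 : ‖(ξ + η) j‖ * A.a j q = ‖ξ j + η j‖ * A.a j q := rfl
      linarith)
    (by
      intro c ξ
      rw [Real.mul_iSup_of_nonneg (norm_nonneg c)]
      refine iSup_congr fun j => ?_
      have h : (c • ξ) j = c * ξ j := rfl
      rw [h, norm_mul, mul_assoc])

/-- The locally convex topology given by the seminorms `|·|_{∞,q}`. -/
instance : TopologicalSpace (KoetheSpace A) :=
  SeminormFamily.moduleFilterBasis (seminorm A) |>.topology

theorem withSeminorms (A : KoetheMatrix) :
    WithSeminorms (E := KoetheSpace A) (seminorm A) := ⟨rfl⟩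

instance : IsTopologicalAddGroup (KoetheSpace A) := (withSeminorms A).topologicalAddGroup
instance : ContinuousSMul ℂ (KoetheSpace A) := (withSeminorms A).continuousSMul

/-- For a finite set `N`, the sequence `e_N` which is 1 on `N` and 0 otherwise. -/
def indicator (A : KoetheMatrix) (N : Finset ℕ) : KoetheSpace A :=
  ⟨fun j => if j ∈ N then 1 else 0, fun q => by
    refine ((N.finite_toSet.image fun j => A.a j q).union
      (Set.finite_singleton (0 : ℝ))).bddAbove.mono ?_
    rintro _ ⟨j, rfl⟩
    by_cases h : j ∈ N
    · exact Or.inl ⟨j, h, by simp [h]⟩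
    · exact Or.inr (by simp [h])⟩

end KoetheSpace

/-- `λ^∞(A) ⊆ c_0`. -/
class KoetheMatrix.SubsetC0 (A : KoetheMatrix) : Prop where
  tendsto_zero : ∀ ξ : KoetheSpace A, Tendsto ξ atTop (𝓝 0)

/-! ### Pointwise multiplication and conjugation on a Köthe space contained in `c_0` -/

namespace KoetheSpace

variable {A : KoetheMatrix}

theorem mul_mem [A.SubsetC0] (ξ η : KoetheSpace A) :
    (fun j => ξ j * η j) ∈ A.submodule := by
  intro q
  obtain ⟨C, hC⟩ := (KoetheMatrix.SubsetC0.tendsto_zero ξ).norm.bddAbove_range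
  obtain ⟨D, hD⟩ := η.2 q
  refine ⟨C * D, ?_⟩
  rintro _ ⟨j, rfl⟩
  have h1 : ‖ξ j‖ ≤ C := hC ⟨j, rfl⟩
  have h2 : ‖η j‖ * A.a j q ≤ D := hD ⟨j, rfl⟩
  simp only [norm_mul, mul_assoc]
  exact mul_le_mul h1 h2 (mul_nonneg (norm_nonneg _) (A.nonneg j q)) ((norm_nonneg _).trans h1)

instance [A.SubsetC0] : NonUnitalCommRing (KoetheSpace A) :=
  { (inferInstance : AddCommGroup (KoetheSpace A)) with
    mul := fun ξ η => ⟨fun j => ξ j * η j, mul_mem ξ η⟩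
    left_distrib := fun ξ η ζ => Subtype.ext (funext fun j => mul_add (ξ j) (η j) (ζ j))
    right_distrib := fun ξ η ζ => Subtype.ext (funext fun j => add_mul (ξ j) (η j) (ζ j))
    zero_mul := fun ξ => Subtype.ext (funext fun j => zero_mul (ξ j))
    mul_zero := fun ξ => Subtype.ext (funext fun j => mul_zero (ξ j))
    mul_assoc := fun ξ η ζ => Subtype.ext (funext fun j => mul_assoc (ξ j) (η j) (ζ j))
    mul_comm := fun ξ η => Subtype.ext (funext fun j => mul_comm (ξ j) (η j)) }

instance [A.SubsetC0] : StarRing (KoetheSpace A) where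
  star ξ := ⟨fun j => star (ξ j), fun q => by simpa using ξ.2 q⟩
  star_involutive ξ := Subtype.ext (funext fun j => star_star (ξ j))
  star_mul ξ η := Subtype.ext (funext fun j => star_mul (ξ j) (η j))
  star_add ξ η := Subtype.ext (funext fun j => star_add (ξ j) (η j))

instance [A.SubsetC0] : StarModule ℂ (KoetheSpace A) where
  star_smul c ξ := Subtype.ext (funext fun j => star_smul c (ξ j))

instance [A.SubsetC0] : IsScalarTower ℂ (KoetheSpace A) (KoetheSpace A) where
  smul_assoc c ξ η := Subtype.ext (funext fun j => smul_assoc c (ξ j) (η j))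

instance [A.SubsetC0] : SMulCommClass ℂ (KoetheSpace A) (KoetheSpace A) where
  smul_comm c ξ η := Subtype.ext (funext fun j => smul_comm c (ξ j) (η j))

/-- The closed *-subalgebra of `λ^∞(A)` generated by `S`: the smallest closed *-subalgebra that
contains `S`. -/
def closedStarAdjoin [A.SubsetC0] (S : Set (KoetheSpace A)) :
    NonUnitalStarSubalgebra ℂ (KoetheSpace A) :=
  sInf {F | IsClosed (F : Set (KoetheSpace A)) ∧ S ⊆ F}

end KoetheSpace

/-! ### Families of blocks -/

/-- A sequence of finite nonempty pairwise disjoint sets of natural numbers. -/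
structure BlockFamily where
  block : ℕ → Finset ℕ
  nonempty : ∀ k, (block k).Nonempty
  disjoint : ∀ k l, k ≠ l → Disjoint (block k) (block l)

namespace KoetheMatrix

/-- The Köthe matrix `(max_{j ∈ N k} a j q)` with row index `k` and column index `q`. -/
def blockMax (A : KoetheMatrix) (N : BlockFamily) : KoetheMatrix where
  a k q := (N.block k).sup' (N.nonempty k) (fun j => A.a j q)
  nonneg k q := by
    obtain ⟨j, hj⟩ := N.nonempty k
    exact (A.nonneg j q).trans (Finset.le_sup' (fun j => A.a j q) hj)
  exists_pos k := by
    obtain ⟨j, hj⟩ := N.nonempty k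
    obtain ⟨q, hq⟩ := A.exists_pos j
    exact ⟨q, hq.trans_le (Finset.le_sup' (fun j => A.a j q) hj)⟩
  mono k q := Finset.sup'_mono_fun fun j _ => A.mono j q

/-- If `λ^∞(A)` is contained in `c_0`, then so is `λ^∞(max_{j ∈ N k} a j q)`, which therefore is a
*-algebra under the pointwise operations. -/
instance (A : KoetheMatrix) (N : BlockFamily) [A.SubsetC0] : (A.blockMax N).SubsetC0 where
  tendsto_zero η := by
    classical
    choose m hm using N.nonempty
    have hinj : Function.Injective m := by
      intro k l hkl
      by_contra hne
      exact Finset.disjoint_left.1 (N.disjoint k l hne) (hm k) (hkl ▸ hm l)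
    have hmem : Function.extend m η 0 ∈ A.submodule := by
      intro q
      obtain ⟨C, hC⟩ := η.2 q
      refine ⟨max C 0, ?_⟩
      rintro _ ⟨j, rfl⟩
      by_cases hj : ∃ k, m k = j
      · obtain ⟨k, rfl⟩ := hj
        have h1 : ‖η k‖ * (A.blockMax N).a k q ≤ C := hC ⟨k, rfl⟩
        have h2 : A.a (m k) q ≤ (A.blockMax N).a k q :=
          Finset.le_sup' (fun j => A.a j q) (hm k)
        simp only [hinj.extend_apply]
        exact ((mul_le_mul_of_nonneg_left h2 (norm_nonneg _)).trans h1).trans (le_max_left _ _)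
      · simp [Function.extend_apply' _ _ _ hj]
    have ht := (SubsetC0.tendsto_zero (⟨_, hmem⟩ : KoetheSpace A)).comp
      hinj.nat_tendsto_atTop
    refine ht.congr fun k => ?_
    exact hinj.extend_apply _ _ k

end KoetheMatrix

/-- The *-subalgebra `E` of `λ^∞(A)` contains the sequences `e_{N k}`, they form a Schauder basis
of `E`, and there is an isomorphism of Fréchet *-algebras (a *-algebra isomorphism which is a
homeomorphism) from `E` onto `λ^∞(max_{j ∈ N k} a j q)` with `e_{N k} ↦ e_k`. -/
def HasBlockBasis {A : KoetheMatrix} [A.SubsetC0]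
    (E : NonUnitalStarSubalgebra ℂ (KoetheSpace A)) (N : BlockFamily) : Prop :=
  ∃ e : ℕ → E, (∀ k, (e k : KoetheSpace A) = KoetheSpace.indicator A (N.block k)) ∧
    IsSchauderBasis e ∧
    ∃ Φ : E ≃⋆ₐ[ℂ] KoetheSpace (A.blockMax N), Continuous Φ ∧ Continuous Φ.symm ∧
      ∀ k, Φ (e k) = KoetheSpace.indicator (A.blockMax N) {k}

end

/-!
In a nuclear space unconditionally bounded families are absolutely summable. Applied to the family
`ξ j • e_j` this shows that `ξ j * a j q → 0` for every `ξ` in a nuclear `λ^∞(A)` and every `q`, so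
the unit vectors form a Schauder basis; the matrix of block maxima inherits this property.

Extending a sequence to be constant on the blocks preserves all the defining seminorms, and hence
embeds `λ^∞(max_{j ∈ N k} a j q)` topologically as the *-algebra of the sequences which are
constant on the blocks and vanish elsewhere. It remains to see that every infinite-dimensional
closed subalgebra `E` is of this form. The blocks are the fibres of the map which sends `j` to the
character `ξ ↦ ξ j` of `E`, over the nonzero characters. If `χ` is one of them, then some `ξ ∈ E` is
`1` on its fibre and of modulus less than `1/2` at all but finitely many other coordinates; some
`η ∈ E` is `1` on the fibre and `0` at these exceptional coordinates, and the products `ξ ^ m * η`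
converge to the indicator of the fibre.
-/

/-! ### Absolute summability in nuclear spaces -/

theorem sum_norm_le_of_forall_norm_sum_mul_le {𝕜 ι : Type*} [RCLike 𝕜] {s : Finset ι} {z : ι → 𝕜}
    {B : ℝ} (h : ∀ u : ι → 𝕜, (∀ i, ‖u i‖ = 1) → ‖∑ i ∈ s, u i * z i‖ ≤ B) :
    ∑ i ∈ s, ‖z i‖ ≤ B := by
  choose u hu huz using fun i => RCLike.exists_norm_eq_mul_self (z i)
  have hsum : ∑ i ∈ s, u i * z i = ((∑ i ∈ s, ‖z i‖ : ℝ) : 𝕜) := by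
    simp only [← huz, RCLike.ofReal_sum]
  simpa only [hsum, RCLike.norm_ofReal, abs_of_nonneg (Finset.sum_nonneg fun i _ =>
    norm_nonneg (z i))] using h u hu

theorem IsNuclearSpace.summable_seminorm {E ι : Type*} [AddCommGroup E] [Module ℂ E]
    [TopologicalSpace E] (hE : IsNuclearSpace E) {x : ι → E}
    (hx : ∀ q : Seminorm ℂ E, Continuous q → ∃ D, ∀ (s : Finset ι) (u : ι → ℂ),
      (∀ i, ‖u i‖ = 1) → q (∑ i ∈ s, u i • x i) ≤ D)
    {p : Seminorm ℂ E} (hp : Continuous p) : Summable fun i => p (x i) := by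
  obtain ⟨q, hq, -, f, c, y, hf, hcy, hfy⟩ := hE p hp
  obtain ⟨D, hD⟩ := hx q hq
  have hf_sum (n : ℕ) (s : Finset ι) : ∑ i ∈ s, ‖f n (x i)‖ ≤ c n * D :=
    sum_norm_le_of_forall_norm_sum_mul_le fun u hu => by
      simpa only [map_sum, map_smul, smul_eq_mul] using
        (hf n _).trans (mul_le_mul_of_nonneg_left (hD s u hu) (c n).2)
  have hsummable (v : E) : Summable fun n => ‖f n v‖ * ‖y n‖ :=
    .of_nonneg_of_le (fun n => by positivity)
      (fun n => (mul_le_mul_of_nonneg_right (hf n v) (norm_nonneg _)).trans_eq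
        (mul_right_comm _ _ _)) (hcy.mul_right (q v))
  have hp_le (v : E) : p v ≤ ∑' n, ‖f n v‖ * ‖y n‖ := by
    have hnorm : ‖Seminorm.LocalSpace.toBanach p v‖ = p v := UniformSpace.Completion.norm_coe _
    have hsummable_norm : Summable fun n => ‖f n v • y n‖ := by
      simpa only [norm_smul] using hsummable v
    rw [← hnorm, ← (hfy v).tsum_eq]
    simpa only [norm_smul] using norm_tsum_le_tsum_norm hsummable_norm
  refine summable_of_sum_le (c := ∑' n, c n * ‖y n‖ * D) (fun i => apply_nonneg p _) fun s => ?_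
  calc ∑ i ∈ s, p (x i) ≤ ∑ i ∈ s, ∑' n, ‖f n (x i)‖ * ‖y n‖ :=
        Finset.sum_le_sum fun i _ => hp_le (x i)
    _ = ∑' n, ∑ i ∈ s, ‖f n (x i)‖ * ‖y n‖ :=
        (Summable.tsum_finsetSum fun i _ => hsummable (x i)).symm
    _ ≤ ∑' n, c n * ‖y n‖ * D := by
        refine Summable.tsum_le_tsum (fun n => ?_) (summable_sum fun i _ => hsummable (x i))
          (hcy.mul_right D)
        rw [← Finset.sum_mul, mul_right_comm]
        exact mul_le_mul_of_nonneg_right (hf_sum n s) (norm_nonneg _)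

/-! ### Transport of Schauder bases -/

namespace IsSchauderBasis

variable {X Y : Type*} [AddCommGroup X] [Module ℂ X] [TopologicalSpace X]
  [AddCommGroup Y] [Module ℂ Y] [TopologicalSpace Y] {e : ℕ → X}

theorem map (he : IsSchauderBasis e) (Φ : X ≃L[ℂ] Y) : IsSchauderBasis fun k => Φ (e k) := by
  have tendsto_iff (c : ℕ → ℂ) (y : Y) :
      Tendsto (fun n => ∑ k ∈ Finset.range n, c k • Φ (e k)) atTop (𝓝 y) ↔
        Tendsto (fun n => ∑ k ∈ Finset.range n, c k • e k) atTop (𝓝 (Φ.symm y)) := by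
    simp only [Φ.symm.toHomeomorph.isInducing.tendsto_nhds_iff, Function.comp_def,
      ContinuousLinearEquiv.coe_toHomeomorph, map_sum, map_smul,
      ContinuousLinearEquiv.symm_apply_apply]
  obtain ⟨hunique, f, hf⟩ := he
  refine ⟨fun y => ?_, fun k => (f k).comp (Φ.symm : Y →L[ℂ] X), fun y => ?_⟩
  · simpa only [tendsto_iff] using hunique (Φ.symm y)
  · exact (tendsto_iff _ y).2 (hf (Φ.symm y))

theorem eq_top_of_isClosed (he : IsSchauderBasis e) {S : Submodule ℂ X}
    (hS : IsClosed (S : Set X)) (hmem : ∀ k, e k ∈ S) : S = ⊤ := by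
  refine (Submodule.eq_top_iff').2 fun x => ?_
  obtain ⟨c, hc, -⟩ := he.1 x
  exact hS.mem_of_tendsto hc
    (Eventually.of_forall fun n => sum_mem fun k _ => S.smul_mem (c k) (hmem k))

end IsSchauderBasis

/-! ### Coordinates of a Köthe space -/

namespace KoetheSpace

variable {A : KoetheMatrix}

@[ext] theorem ext {ξ η : KoetheSpace A} (h : ∀ j, ξ j = η j) : ξ = η :=
  Subtype.ext (funext h)

@[simp] theorem sub_apply (ξ η : KoetheSpace A) (j : ℕ) : (ξ - η) j = ξ j - η j := rfl

@[simp] theorem smul_apply (c : ℂ) (ξ : KoetheSpace A) (j : ℕ) : (c • ξ) j = c * ξ j := rfl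

@[simp] theorem mul_apply [A.SubsetC0] (ξ η : KoetheSpace A) (j : ℕ) : (ξ * η) j = ξ j * η j := rfl

@[simp] theorem indicator_apply (N : Finset ℕ) (j : ℕ) :
    indicator A N j = if j ∈ N then 1 else 0 := rfl

theorem norm_apply_mul_le_seminorm (ξ : KoetheSpace A) (q j : ℕ) :
    ‖ξ j‖ * A.a j q ≤ seminorm A q ξ :=
  le_ciSup (ξ.2 q) j

theorem seminorm_le {ξ : KoetheSpace A} {q : ℕ} {C : ℝ} (h : ∀ j, ‖ξ j‖ * A.a j q ≤ C) :
    seminorm A q ξ ≤ C :=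
  ciSup_le h

theorem continuous_apply (j : ℕ) : Continuous fun ξ : KoetheSpace A => ξ j := by
  obtain ⟨q, hq⟩ := A.exists_pos j
  refine continuous_iff_continuousAt.2 fun ξ => tendsto_iff_norm_sub_tendsto_zero.2 ?_
  have hcont : Continuous fun η => seminorm A q (η - ξ) / A.a j q :=
    (((withSeminorms A).continuous_seminorm q).comp (continuous_sub_right ξ)).div_const _
  exact squeeze_zero (fun η => norm_nonneg _)
    (fun η => (le_div_iff₀ hq).2 (norm_apply_mul_le_seminorm (η - ξ) q j))
    (by simpa using hcont.tendsto ξ)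

/-- The `j`-th coordinate, as a continuous linear functional on `λ^∞(A)`. -/
def coord (A : KoetheMatrix) (j : ℕ) : KoetheSpace A →L[ℂ] ℂ where
  toFun ξ := ξ j
  map_add' _ _ := rfl
  map_smul' _ _ := rfl
  cont := continuous_apply j

@[simp] theorem sum_apply {ι : Type*} (s : Finset ι) (ξ : ι → KoetheSpace A) (j : ℕ) :
    (∑ i ∈ s, ξ i) j = ∑ i ∈ s, ξ i j :=
  map_sum (coord A j) ξ s

theorem sum_smul_indicator_singleton_apply (s : Finset ℕ) (c : ℕ → ℂ) (j : ℕ) :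
    (∑ k ∈ s, c k • indicator A {k}) j = if j ∈ s then c j else 0 := by
  simp

theorem exists_forall_le_of_continuous {p : Seminorm ℂ (KoetheSpace A)} (hp : Continuous p)
    (ξ : KoetheSpace A) : ∃ D, ∀ η : KoetheSpace A, (∀ j, ‖η j‖ ≤ ‖ξ j‖) → p η ≤ D := by
  obtain ⟨s, C, -, hpC⟩ := Seminorm.bound_of_continuous (withSeminorms A) p hp
  refine ⟨C * s.sup (seminorm A) ξ, fun η hη =>
    (hpC η).trans (mul_le_mul_of_nonneg_left ?_ C.2)⟩
  refine Seminorm.finset_sup_apply_le (apply_nonneg _ _) fun q hq => ?_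
  refine (seminorm_le fun j => ?_).trans (Seminorm.le_finset_sup_apply hq)
  exact (mul_le_mul_of_nonneg_right (hη j) (A.nonneg j q)).trans (norm_apply_mul_le_seminorm ξ q j)

theorem summable_norm_apply_mul_of_isNuclearSpace (hA : IsNuclearSpace (KoetheSpace A))
    (ξ : KoetheSpace A) (q : ℕ) : Summable fun j => ‖ξ j‖ * A.a j q := by
  have hsummable : Summable fun j => seminorm A q (ξ j • indicator A {j}) := by
    refine hA.summable_seminorm (fun p hp => ?_) ((withSeminorms A).continuous_seminorm q)
    obtain ⟨D, hD⟩ := exists_forall_le_of_continuous hp ξ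
    refine ⟨D, fun s u hu => hD _ fun j => ?_⟩
    have hsum : (∑ k ∈ s, u k • ξ k • indicator A {k}) j = if j ∈ s then u j * ξ j else 0 := by
      simp only [smul_smul, sum_smul_indicator_singleton_apply s fun k => u k * ξ k]
    rw [hsum]
    split_ifs
    · simp [hu]
    · simp
  refine hsummable.of_nonneg_of_le (fun j => mul_nonneg (norm_nonneg _) (A.nonneg j q)) fun j => ?_
  simpa using norm_apply_mul_le_seminorm (ξ j • indicator A {j}) q j

end KoetheSpace

/-! ### The unit vectors as a Schauder basis -/

/-- `λ^∞(A)` coincides with the Köthe space `c_0(A)` of the sequences `ξ` with `ξ j * a j q → 0` for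
all `q`. This consequence of nuclearity suffices for all the expansions below. -/
def KoetheMatrix.LInftyEqC0 (A : KoetheMatrix) : Prop :=
  ∀ (ξ : KoetheSpace A) (q : ℕ), Tendsto (fun j => ‖ξ j‖ * A.a j q) atTop (𝓝 0)

theorem IsNuclearSpace.lInftyEqC0 {A : KoetheMatrix} (hA : IsNuclearSpace (KoetheSpace A)) :
    A.LInftyEqC0 := fun ξ q =>
  (KoetheSpace.summable_norm_apply_mul_of_isNuclearSpace hA ξ q).tendsto_atTop_zero

namespace KoetheMatrix.LInftyEqC0

open KoetheSpace

variable {A : KoetheMatrix}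

theorem tendsto_sum_smul_indicator_singleton (hA : A.LInftyEqC0) (ξ : KoetheSpace A) :
    Tendsto (fun n => ∑ k ∈ Finset.range n, ξ k • indicator A {k}) atTop (𝓝 ξ) := by
  rw [(withSeminorms A).tendsto_nhds]
  intro q ε hε
  obtain ⟨m, hm⟩ := eventually_atTop.1 ((hA ξ q).eventually_lt_const (half_pos hε))
  filter_upwards [eventually_ge_atTop m] with n hn
  refine (seminorm_le fun j => ?_).trans_lt (half_lt_self hε)
  rw [sub_apply, sum_smul_indicator_singleton_apply]
  split_ifs with hj
  · simpa using (half_pos hε).le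
  · rw [zero_sub, norm_neg]
    exact (hm j (hn.trans (by simpa using hj))).le

theorem isSchauderBasis_indicator_singleton (hA : A.LInftyEqC0) :
    IsSchauderBasis fun k => indicator A {k} := by
  refine ⟨fun ξ => ⟨ξ, hA.tendsto_sum_smul_indicator_singleton ξ, fun c hc => funext fun j => ?_⟩,
    coord A, hA.tendsto_sum_smul_indicator_singleton⟩
  refine tendsto_nhds_unique (tendsto_const_nhds.congr' ?_)
    (((continuous_apply j).tendsto ξ).comp hc)
  filter_upwards [eventually_gt_atTop j] with n hn
  rw [Function.comp_apply, sum_smul_indicator_singleton_apply, if_pos (Finset.mem_range.2 hn)]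

end KoetheMatrix.LInftyEqC0

/-! ### Sequences which are constant on blocks -/

namespace BlockFamily

theorem eq_of_mem (N : BlockFamily) {j k l : ℕ} (hk : j ∈ N.block k) (hl : j ∈ N.block l) :
    k = l :=
  not_imp_comm.1 (N.disjoint k l) (Finset.not_disjoint_iff.2 ⟨j, hk, hl⟩)

theorem exists_mem_block_iff {α : Type*} {f : ℕ → α} {S : Set α} (hS : S ⊆ Set.range f)
    (hinf : S.Infinite) (hfin : ∀ a ∈ S, (f ⁻¹' {a}).Finite) :
    ∃ (N : BlockFamily) (b : ℕ ≃ S), ∀ j k, j ∈ N.block k ↔ f j = b k := by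
  have := ((Set.countable_range f).mono hS).to_subtype
  have := hinf.to_subtype
  obtain ⟨_⟩ := nonempty_denumerable S
  let b : ℕ ≃ S := (Denumerable.eqv S).symm
  refine ⟨⟨fun k => (hfin (b k) (b k).2).toFinset, fun k => ?_, fun k l hkl => ?_⟩, b, by simp⟩
  · obtain ⟨j, hj⟩ := hS (b k).2
    exact ⟨j, by simpa using hj⟩
  · refine Finset.disjoint_left.2 fun j hk hl => hkl (b.injective (Subtype.ext ?_))
    simp_all

section Extend

variable {M P Q : Type*} [Zero M] [Zero P] [Zero Q] (N : BlockFamily)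

open Classical in
/-- The sequence with the value `η k` on the `k`-th block and `0` outside of the blocks. -/
noncomputable def extend (η : ℕ → M) (j : ℕ) : M :=
  if h : ∃ k, j ∈ N.block k then η h.choose else 0

theorem extend_of_mem (η : ℕ → M) {j k : ℕ} (h : j ∈ N.block k) : N.extend η j = η k := by
  have hex : ∃ k, j ∈ N.block k := ⟨k, h⟩
  rw [extend, dif_pos hex, N.eq_of_mem hex.choose_spec h]

theorem extend_of_forall_notMem (η : ℕ → M) {j : ℕ} (h : ∀ k, j ∉ N.block k) :
    N.extend η j = 0 :=
  dif_neg (not_exists.2 h)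

theorem extend_map {g : M → P} (hg : g 0 = 0) (η : ℕ → M) (j : ℕ) :
    N.extend (fun k => g (η k)) j = g (N.extend η j) := by
  unfold extend
  split_ifs
  exacts [rfl, hg.symm]

theorem extend_map₂ {g : M → P → Q} (hg : g 0 0 = 0) (η : ℕ → M) (ζ : ℕ → P) (j : ℕ) :
    N.extend (fun k => g (η k) (ζ k)) j = g (N.extend η j) (N.extend ζ j) := by
  unfold extend
  split_ifs
  exacts [rfl, hg.symm]

end Extend

end BlockFamily

namespace KoetheMatrix

variable (A : KoetheMatrix) (N : BlockFamily)

theorem le_blockMax {j k : ℕ} (hj : j ∈ N.block k) (q : ℕ) : A.a j q ≤ (A.blockMax N).a k q :=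
  Finset.le_sup' (fun j => A.a j q) hj

theorem exists_mem_blockMax_eq (k q : ℕ) : ∃ j ∈ N.block k, (A.blockMax N).a k q = A.a j q :=
  Finset.exists_mem_eq_sup' (N.nonempty k) fun j => A.a j q

end KoetheMatrix

namespace KoetheSpace

variable {A : KoetheMatrix} (N : BlockFamily)

theorem norm_extend_mul_le_seminorm (η : KoetheSpace (A.blockMax N)) (j q : ℕ) :
    ‖N.extend η j‖ * A.a j q ≤ seminorm (A.blockMax N) q η := by
  by_cases h : ∃ k, j ∈ N.block k
  · obtain ⟨k, hk⟩ := h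
    rw [N.extend_of_mem η hk]
    exact (mul_le_mul_of_nonneg_left (A.le_blockMax N hk q) (norm_nonneg _)).trans
      (norm_apply_mul_le_seminorm η q k)
  · rw [N.extend_of_forall_notMem η (not_exists.1 h), norm_zero, zero_mul]
    exact apply_nonneg _ _

theorem extend_mem_submodule (η : KoetheSpace (A.blockMax N)) : N.extend η ∈ A.submodule :=
  fun q => ⟨seminorm (A.blockMax N) q η,
    Set.forall_mem_range.2 fun j => norm_extend_mul_le_seminorm N η j q⟩

variable [A.SubsetC0]

/-- The embedding of `λ^∞(max_{j ∈ N k} a j q)` into `λ^∞(A)` which spreads the `k`-th coordinate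
over the `k`-th block. -/
noncomputable def blockExtend (A : KoetheMatrix) [A.SubsetC0] (N : BlockFamily) :
    KoetheSpace (A.blockMax N) →⋆ₙₐ[ℂ] KoetheSpace A where
  toFun η := ⟨N.extend η, extend_mem_submodule N η⟩
  map_smul' c η := ext (N.extend_map (mul_zero c) η)
  map_zero' := ext fun j => N.extend_map (g := fun _ : ℂ => (0 : ℂ)) rfl 0 j
  map_add' η ζ := ext (N.extend_map₂ (add_zero 0) η ζ)
  map_mul' η ζ := ext (N.extend_map₂ (mul_zero 0) η ζ)
  map_star' η := ext (N.extend_map (star_zero ℂ) η)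

theorem blockExtend_of_mem (η : KoetheSpace (A.blockMax N)) {j k : ℕ} (h : j ∈ N.block k) :
    blockExtend A N η j = η k :=
  N.extend_of_mem η h

theorem blockExtend_of_forall_notMem (η : KoetheSpace (A.blockMax N)) {j : ℕ}
    (h : ∀ k, j ∉ N.block k) : blockExtend A N η j = 0 :=
  N.extend_of_forall_notMem η h

theorem blockExtend_injective : Function.Injective (blockExtend A N) := fun η ζ h => ext fun k => by
  obtain ⟨j, hj⟩ := N.nonempty k
  rw [← blockExtend_of_mem N η hj, h, blockExtend_of_mem N ζ hj]

theorem blockExtend_indicator_singleton (k : ℕ) :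
    blockExtend A N (indicator (A.blockMax N) {k}) = indicator A (N.block k) := by
  ext j
  by_cases h : ∃ l, j ∈ N.block l
  · obtain ⟨l, hl⟩ := h
    have hiff : j ∈ N.block k ↔ l = k := ⟨N.eq_of_mem hl, fun h => h ▸ hl⟩
    simp [blockExtend_of_mem N _ hl, hiff]
  · rw [blockExtend_of_forall_notMem N _ (not_exists.1 h), indicator_apply,
      if_neg (not_exists.1 h k)]

theorem seminorm_blockExtend (η : KoetheSpace (A.blockMax N)) (q : ℕ) :
    seminorm A q (blockExtend A N η) = seminorm (A.blockMax N) q η := by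
  refine le_antisymm (seminorm_le fun j => norm_extend_mul_le_seminorm N η j q)
    (seminorm_le fun k => ?_)
  obtain ⟨j, hj, hmax⟩ := A.exists_mem_blockMax_eq N k q
  rw [hmax, ← blockExtend_of_mem N η hj]
  exact norm_apply_mul_le_seminorm _ q j

theorem isInducing_blockExtend : IsInducing (blockExtend A N) := by
  let T : KoetheSpace (A.blockMax N) →ₗ[ℂ] KoetheSpace A := blockExtend A N
  have hcomp : SeminormFamily.comp (seminorm A) T = seminorm (A.blockMax N) := by
    ext q η
    exact seminorm_blockExtend N η q
  have hinduced := T.withSeminorms_induced (withSeminorms A)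
  rw [hcomp] at hinduced
  exact ⟨(withSeminorms (A.blockMax N)).topology_eq_withSeminorms.trans
    (WithSeminorms.topology_eq_withSeminorms (topology := .induced T inferInstance) hinduced).symm⟩

end KoetheSpace

open KoetheSpace in
theorem KoetheMatrix.LInftyEqC0.blockMax {A : KoetheMatrix} [A.SubsetC0] (hA : A.LInftyEqC0)
    (N : BlockFamily) : (A.blockMax N).LInftyEqC0 := by
  intro η q
  choose m hm hmax using fun k => A.exists_mem_blockMax_eq N k q
  have hinj : Function.Injective m := fun k l hkl => N.eq_of_mem (hm k) (hkl ▸ hm l)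
  refine ((hA (blockExtend A N η) q).comp hinj.nat_tendsto_atTop).congr fun k => ?_
  rw [Function.comp_apply, hmax, blockExtend_of_mem N η (hm k)]

namespace KoetheSpace

variable {A : KoetheMatrix} [A.SubsetC0] (N : BlockFamily)

/-- The *-algebra of the sequences in `λ^∞(A)` which are constant on each block and vanish outside
of the blocks; see `mem_blockSubalgebra_iff`. -/
noncomputable def blockSubalgebra (A : KoetheMatrix) [A.SubsetC0] (N : BlockFamily) :
    NonUnitalStarSubalgebra ℂ (KoetheSpace A) :=
  NonUnitalStarAlgHom.range (blockExtend A N)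

theorem indicator_block_mem_blockSubalgebra (k : ℕ) :
    indicator A (N.block k) ∈ blockSubalgebra A N :=
  ⟨_, blockExtend_indicator_singleton N k⟩

theorem mem_blockSubalgebra_iff {ξ : KoetheSpace A} :
    ξ ∈ blockSubalgebra A N ↔ (∀ k, ∀ i ∈ N.block k, ∀ j ∈ N.block k, ξ i = ξ j) ∧
      ∀ j, (∀ k, j ∉ N.block k) → ξ j = 0 := by
  constructor
  · rintro ⟨η, rfl⟩
    exact ⟨fun k i hi j hj => (blockExtend_of_mem N η hi).trans (blockExtend_of_mem N η hj).symm,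
      fun j => blockExtend_of_forall_notMem N η⟩
  · rintro ⟨hconst, hzero⟩
    choose m hm using N.nonempty
    have hmem : (fun k => ξ (m k)) ∈ (A.blockMax N).submodule := fun q =>
      ⟨seminorm A q ξ, Set.forall_mem_range.2 fun k => by
        obtain ⟨j, hj, hmax⟩ := A.exists_mem_blockMax_eq N k q
        change ‖ξ (m k)‖ * _ ≤ _
        rw [hmax, hconst k _ (hm k) j hj]
        exact norm_apply_mul_le_seminorm ξ q j⟩
    refine ⟨⟨_, hmem⟩, ext fun j => ?_⟩
    by_cases h : ∃ k, j ∈ N.block k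
    · obtain ⟨k, hk⟩ := h
      exact (blockExtend_of_mem N _ hk).trans (hconst k _ (hm k) j hk)
    · exact (blockExtend_of_forall_notMem N _ (not_exists.1 h)).trans
        (hzero j (not_exists.1 h)).symm

theorem isClosed_blockSubalgebra : IsClosed (blockSubalgebra A N : Set (KoetheSpace A)) := by
  have hset : (blockSubalgebra A N : Set (KoetheSpace A)) =
      {ξ | (∀ k, ∀ i ∈ N.block k, ∀ j ∈ N.block k, ξ i = ξ j) ∧
        ∀ j, (∀ k, j ∉ N.block k) → ξ j = 0} :=
    Set.ext fun _ => mem_blockSubalgebra_iff N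
  simp only [hset, Set.ofPred_and, Set.ofPred_forall]
  exact .inter
    (isClosed_iInter fun k => isClosed_iInter fun i => isClosed_iInter fun _ =>
      isClosed_iInter fun j => isClosed_iInter fun _ =>
        isClosed_eq (continuous_apply i) (continuous_apply j))
    (isClosed_iInter fun j => isClosed_iInter fun _ =>
      isClosed_eq (continuous_apply j) continuous_const)

theorem blockSubalgebra_subset_of_isClosed (hA : A.LInftyEqC0) {S : Submodule ℂ (KoetheSpace A)}
    (hS : IsClosed (S : Set (KoetheSpace A))) (hmem : ∀ k, indicator A (N.block k) ∈ S) :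
    (blockSubalgebra A N : Set (KoetheSpace A)) ⊆ S := by
  let T : KoetheSpace (A.blockMax N) →ₗ[ℂ] KoetheSpace A := blockExtend A N
  have hcomap : S.comap T = ⊤ :=
    (hA.blockMax N).isSchauderBasis_indicator_singleton.eq_top_of_isClosed
      (hS.preimage (isInducing_blockExtend N).continuous) fun k =>
        (blockExtend_indicator_singleton (A := A) N k ▸ hmem k :)
  rintro _ ⟨η, rfl⟩
  exact Submodule.eq_top_iff'.1 hcomap η

theorem closedStarAdjoin_range_indicator_block (hA : A.LInftyEqC0) :
    closedStarAdjoin (Set.range fun k => indicator A (N.block k)) = blockSubalgebra A N := by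
  refine le_antisymm (sInf_le ⟨isClosed_blockSubalgebra N,
    Set.range_subset_iff.2 (indicator_block_mem_blockSubalgebra N)⟩) (le_sInf fun F hF => ?_)
  exact blockSubalgebra_subset_of_isClosed N hA (S := F.toSubmodule) hF.1
    fun k => hF.2 (Set.mem_range_self k)

/-- `blockExtend` as an isomorphism onto its range. -/
noncomputable def blockEquiv (A : KoetheMatrix) [A.SubsetC0] (N : BlockFamily) :
    KoetheSpace (A.blockMax N) ≃⋆ₐ[ℂ] blockSubalgebra A N :=
  StarAlgEquiv.ofInjective' (blockExtend A N) (blockExtend_injective N)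

theorem continuous_blockEquiv : Continuous (blockEquiv A N) :=
  (isInducing_blockExtend N).continuous.subtype_mk _

theorem continuous_blockEquiv_symm : Continuous (blockEquiv A N).symm :=
  (isInducing_blockExtend N).continuous_iff.2 <| continuous_subtype_val.congr fun x =>
    congrArg Subtype.val ((blockEquiv A N).apply_symm_apply x).symm

theorem hasBlockBasis_blockSubalgebra (hA : A.LInftyEqC0) :
    HasBlockBasis (blockSubalgebra A N) N := by
  let Φ : KoetheSpace (A.blockMax N) ≃L[ℂ] blockSubalgebra A N :=
    { blockEquiv A N with
      continuous_toFun := continuous_blockEquiv N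
      continuous_invFun := continuous_blockEquiv_symm N }
  exact ⟨fun k => Φ (indicator (A.blockMax N) {k}), blockExtend_indicator_singleton N,
    (hA.blockMax N).isSchauderBasis_indicator_singleton.map Φ, (blockEquiv A N).symm,
    continuous_blockEquiv_symm N, continuous_blockEquiv N,
    fun k => (blockEquiv A N).symm_apply_apply _⟩

end KoetheSpace

/-! ### Indicators in closed subalgebras -/

theorem exists_apply_eq_one_and_forall_apply_eq_zero {F B : Type*} [Field F]
    [NonUnitalNonAssocRing B] [Module F B] {χ : B →ₙₐ[F] F} (hχ : χ ≠ 0)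
    (K : Finset (B →ₙₐ[F] F)) (hK : χ ∉ K) : ∃ b, χ b = 1 ∧ ∀ ψ ∈ K, ψ b = 0 := by
  classical
  induction K using Finset.induction_on with
  | empty =>
    obtain ⟨b, hb⟩ := DFunLike.ne_iff.1 hχ
    exact ⟨(χ b)⁻¹ • b, by simpa using inv_mul_cancel₀ hb, by simp⟩
  | insert ψ K _ ih =>
    obtain ⟨b, hb, hbK⟩ := ih fun h => hK (Finset.mem_insert_of_mem h)
    obtain ⟨c, hc⟩ := DFunLike.ne_iff.1 fun h : χ = ψ => hK (h ▸ Finset.mem_insert_self ψ K)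
    have hsub : χ c - ψ c ≠ 0 := sub_ne_zero.2 hc
    refine ⟨(χ c - ψ c)⁻¹ • (b * c - ψ c • b), ?_, fun φ hφ => ?_⟩
    · simp [hb, hsub]
    · rcases Finset.mem_insert.1 hφ with rfl | hφ
      · simp [mul_comm]
      · simp [hbK φ hφ]

namespace KoetheSpace

variable {A : KoetheMatrix} [A.SubsetC0]

theorem finite_setOf_le_norm_apply (ξ : KoetheSpace A) {ε : ℝ} (hε : 0 < ε) :
    {j | ε ≤ ‖ξ j‖}.Finite := by
  have hlim := (tendsto_zero_iff_norm_tendsto_zero.1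
    (KoetheMatrix.SubsetC0.tendsto_zero ξ)).eventually_lt_const hε
  rw [← Nat.cofinite_eq_atTop, eventually_cofinite] at hlim
  simpa only [not_lt] using hlim

theorem mul_left_iterate_apply (ξ η : KoetheSpace A) (m j : ℕ) :
    ((ξ * ·)^[m] η) j = ξ j ^ m * η j := by
  induction m with
  | zero => simp
  | succ m ih => rw [Function.iterate_succ_apply', mul_apply, ih, pow_succ', mul_assoc]

theorem tendsto_mul_left_iterate {ξ η : KoetheSpace A} {C : Finset ℕ} {r : ℝ} (hr₀ : 0 ≤ r)
    (hr₁ : r < 1) (hC : ∀ j ∈ C, ξ j = 1) (hCc : ∀ j ∉ C, η j = 0 ∨ ‖ξ j‖ ≤ r) :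
    Tendsto (fun m => (ξ * ·)^[m] η) atTop (𝓝 (indicator A C * η)) := by
  rw [(withSeminorms A).tendsto_nhds]
  intro q ε hε
  have hlim : Tendsto (fun m : ℕ => r ^ m * seminorm A q η) atTop (𝓝 0) := by
    simpa using (tendsto_pow_atTop_nhds_zero_of_lt_one hr₀ hr₁).mul_const (seminorm A q η)
  filter_upwards [hlim.eventually_lt_const hε] with m hm
  refine (seminorm_le fun j => ?_).trans_lt hm
  have hbound : 0 ≤ r ^ m * seminorm A q η := mul_nonneg (pow_nonneg hr₀ m) (apply_nonneg _ _)
  rw [sub_apply, mul_left_iterate_apply, mul_apply, indicator_apply]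
  by_cases hj : j ∈ C
  · simpa [hj, hC j hj] using hbound
  · rw [if_neg hj, zero_mul, sub_zero, norm_mul, norm_pow, mul_assoc]
    rcases hCc j hj with hη | hξ
    · simpa [hη] using hbound
    · exact mul_le_mul (pow_le_pow_left₀ (norm_nonneg _) hξ m) (norm_apply_mul_le_seminorm η q j)
        (mul_nonneg (norm_nonneg _) (A.nonneg j q)) (pow_nonneg hr₀ m)

/-- The character `ξ ↦ ξ j` of a subalgebra `E`. -/
def evalCharacter (E : NonUnitalSubalgebra ℂ (KoetheSpace A)) (j : ℕ) : E →ₙₐ[ℂ] ℂ where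
  toFun ξ := (ξ : KoetheSpace A) j
  map_smul' _ _ := rfl
  map_zero' := rfl
  map_add' _ _ := rfl
  map_mul' _ _ := rfl

variable {E : NonUnitalSubalgebra ℂ (KoetheSpace A)}

theorem finite_preimage_evalCharacter {χ : E →ₙₐ[ℂ] ℂ} (hχ : χ ≠ 0) :
    (evalCharacter E ⁻¹' {χ}).Finite := by
  obtain ⟨ξ, hξ⟩ := DFunLike.ne_iff.1 hχ
  refine (finite_setOf_le_norm_apply (ξ : KoetheSpace A) (norm_pos_iff.2 hξ)).subset ?_
  rintro j rfl
  exact le_refl ‖(ξ : KoetheSpace A) j‖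

theorem infinite_evalCharacter_ne_zero (hE : ¬ FiniteDimensional ℂ E) :
    (Set.range (evalCharacter E) \ {0}).Infinite := by
  intro hfin
  have := hfin.to_subtype
  let evalAll : E →ₗ[ℂ] (↥(Set.range (evalCharacter E) \ {0}) → ℂ) :=
    LinearMap.pi fun χ => (χ : E →ₙₐ[ℂ] ℂ)
  refine hE (.of_injective evalAll ((injective_iff_map_eq_zero _).2 fun ξ hξ => ?_))
  refine Subtype.ext (ext fun j => by_contra fun hj => hj ?_)
  have hne : evalCharacter E j ≠ 0 := fun h => hj (DFunLike.congr_fun h ξ)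
  exact congrFun hξ ⟨evalCharacter E j, Set.mem_range_self j, hne⟩

theorem indicator_mem_of_isClosed (hE : IsClosed (E : Set (KoetheSpace A))) {χ : E →ₙₐ[ℂ] ℂ}
    (hχ : χ ≠ 0) {C : Finset ℕ} (hC : ∀ j, j ∈ C ↔ evalCharacter E j = χ) :
    indicator A C ∈ E := by
  classical
  have eq_one {ξ : E} (hξ : χ ξ = 1) : ∀ j ∈ C, (ξ : KoetheSpace A) j = 1 := fun j hj =>
    (DFunLike.congr_fun ((hC j).1 hj) ξ).trans hξ
  obtain ⟨ξ, hξ, -⟩ := exists_apply_eq_one_and_forall_apply_eq_zero hχ ∅ (by simp)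
  have hfin := finite_setOf_le_norm_apply (ξ : KoetheSpace A) one_half_pos
  obtain ⟨η, hη, hη_zero⟩ := exists_apply_eq_one_and_forall_apply_eq_zero hχ
    ((hfin.toFinset \ C).image (evalCharacter E)) (by simp [hC])
  have hlim := tendsto_mul_left_iterate (η := (η : KoetheSpace A)) (r := 1 / 2) (by norm_num)
    (by norm_num) (eq_one hξ) fun j hj => or_iff_not_imp_right.2 fun hξj =>
      hη_zero _ (Finset.mem_image_of_mem _
        (Finset.mem_sdiff.2 ⟨hfin.mem_toFinset.2 (not_le.1 hξj).le, hj⟩))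
  have hmul : indicator A C * (η : KoetheSpace A) = indicator A C := by
    ext j
    by_cases hj : j ∈ C <;> simp [hj, eq_one hη]
  rw [← hmul]
  refine hE.mem_of_tendsto hlim (Eventually.of_forall fun m => ?_)
  exact Set.MapsTo.iterate (fun ζ hζ => E.mul_mem ξ.2 hζ) m η.2

theorem exists_toNonUnitalSubalgebra_blockSubalgebra_eq (hA : A.LInftyEqC0)
    (hE : IsClosed (E : Set (KoetheSpace A))) (hdim : ¬ FiniteDimensional ℂ E) :
    ∃ N : BlockFamily, (blockSubalgebra A N).toNonUnitalSubalgebra = E := by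
  obtain ⟨N, b, hN⟩ := BlockFamily.exists_mem_block_iff (f := evalCharacter E)
    Set.sdiff_subset (infinite_evalCharacter_ne_zero hdim)
    fun χ hχ => finite_preimage_evalCharacter hχ.2
  refine ⟨N, le_antisymm ?_ fun ξ hξ => (mem_blockSubalgebra_iff N).2 ⟨?_, ?_⟩⟩
  · exact blockSubalgebra_subset_of_isClosed N hA (S := E.toSubmodule) hE fun k =>
      indicator_mem_of_isClosed hE (b k).2.2 fun j => hN j k
  · intro k i hi j hj
    exact DFunLike.congr_fun (((hN i k).1 hi).trans ((hN j k).1 hj).symm) ⟨ξ, hξ⟩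
  · intro j hj
    by_contra hne
    have hχ : evalCharacter E j ≠ 0 := fun h => hne (DFunLike.congr_fun h ⟨ξ, hξ⟩)
    exact hj (b.symm ⟨_, Set.mem_range_self j, hχ⟩) ((hN _ _).2 (by simp))

end KoetheSpace

theorem mainTheorem5_general (A : KoetheMatrix) [A.SubsetC0] (hA : A.LInftyEqC0) :
    (∀ E : NonUnitalSubalgebra ℂ (KoetheSpace A),
      IsClosed (E : Set (KoetheSpace A)) → ¬ FiniteDimensional ℂ E →
        ∃ (F : NonUnitalStarSubalgebra ℂ (KoetheSpace A)) (N : BlockFamily),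
          F.toNonUnitalSubalgebra = E ∧ HasBlockBasis F N) ∧
    (∀ N : BlockFamily,
      HasBlockBasis (KoetheSpace.closedStarAdjoin
        (Set.range fun k => KoetheSpace.indicator A (N.block k))) N) := by
  refine ⟨fun E hE hdim => ?_, fun N => ?_⟩
  · obtain ⟨N, hN⟩ := KoetheSpace.exists_toNonUnitalSubalgebra_blockSubalgebra_eq hA hE hdim
    exact ⟨_, N, hN, KoetheSpace.hasBlockBasis_blockSubalgebra N hA⟩
  · rw [KoetheSpace.closedStarAdjoin_range_indicator_block N hA]
    exact KoetheSpace.hasBlockBasis_blockSubalgebra N hA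

theorem mainTheorem5 (A : KoetheMatrix) [A.SubsetC0] (hA : IsNuclearSpace (KoetheSpace A)) :
    (∀ E : NonUnitalStarSubalgebra ℂ (KoetheSpace A),
      IsClosed (E : Set (KoetheSpace A)) → ¬ FiniteDimensional ℂ E →
        ∃ N : BlockFamily, HasBlockBasis E N) ∧
    (∀ N : BlockFamily,
      HasBlockBasis (KoetheSpace.closedStarAdjoin
        (Set.range fun k => KoetheSpace.indicator A (N.block k))) N) := by
  obtain ⟨hsub, hadjoin⟩ := mainTheorem5_general A hA.lInftyEqC0
  refine ⟨fun E hE hdim => ?_, hadjoin⟩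
  obtain ⟨F, N, hF, hN⟩ := hsub E.toNonUnitalSubalgebra hE hdim
  exact ⟨N, NonUnitalStarSubalgebra.toNonUnitalSubalgebra_injective hF ▸ hN⟩
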